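/- Let $r>0$ and let $\vec G=(G_0,G_1)$ be the Banach couple on $\mathbb R^2$ with norms $\|(x,y)\|_{G_0}=\sqrt{x^2+y^2}$ and $\|(x,y)\|_{G_1}=\sqrt{x^2+ry^2}$. For a couple $\vec A=(A_0,A_1)$ let $K(t,a;\vec A)=\inf\{\|a_0\|_{A_0}+t\|a_1\|_{A_1}: a=a_0+a_1\}$, and let the $K$-divisibility constant $\gamma(\vec A)$ be the infimum of all $C$ with the following property: whenever $a\in A_0+A_1$ and $K(t,a;\vec A)\le\sum_{n\ge1}\phi_n(t)$ for all $t>0$, where the $\phi_n$ are positive concave functions on $(0,\infty)$ with $\sum_n\phi_n(1)<\infty$, there are $a_n\in A_0+A_1$ with $a=\sum_n a_n$ (convergence in the norm $K(1,\cdot\,;\vec A)$) and $K(t,a_n;\vec A)\le C\phi_n(t)$ for all $t>0$ and all $n$. For $a\in[0,\pi/2]$ put $\alpha=(b,c)=(\cos a,\sin a)$ and, for $t>0$, $$\gamma_0(t)=t\sqrt{\frac{b^2}{(1+t)^2}+\frac{r^2c^2}{(1+tr)^2}},\qquad \gamma_1(t)=\sqrt{\frac{b^2}{(1+t)^2}+\frac{rc^2}{(1+tr)^2}},\qquad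 w_0=\gamma_0',\quad w_1=-\gamma_1'.$$ The functions $w_0,w_1$ are positive. Let $\vec P=(L^1_{w_0},L^1_{w_1})$ be the couple of weighted $L^1$ spaces on $(0,\infty)$ with Lebesgue measure, and let $$c_a=\inf\|T\|_{\vec P\to\vec G},\qquad \|T\|_{\vec P\to\vec G}=\max_{j=0,1}\|T\|_{P_j\to G_j},$$ where the infimum is over all bounded linear operators $T:\vec P\to\vec G$ that map the constant function $1$ to $\alpha$. Then: (i) $c_0=c_{\pi/2}=1$; (ii) if $r\ge1$, then $c_a<\sqrt{1+b^2}$ for every $a\in(0,\pi/2)$; if $r\le1$, then $c_a<\sqrt{1+c^2}$ for every $a\in(0,\pi/2)$; (iii) $\gamma(\vec G)<\sqrt2$. -/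

import Mathlib

open MeasureTheory Set Filter Topology
open scoped NNReal ENNReal

/-- A (real) Banach couple: two Banach spaces `A₀`, `A₁` embedded in a common real vector space `V`
in a compatible way.  Closedness of the set of pairs `(x, y)` representing the same vector of `V`
says exactly that the seminorm `inf {‖x‖ + ‖y‖ : x + y = a}` on `A₀ + A₁` is a norm, i.e. that both
spaces embed continuously in a common Hausdorff topological vector space. -/
structure BanachCouple (V A₀ A₁ : Type*) [AddCommGroup V] [Module ℝ V]
    [NormedAddCommGroup A₀] [NormedSpace ℝ A₀] [CompleteSpace A₀]
    [NormedAddCommGroup A₁] [NormedSpace ℝ A₁] [CompleteSpace A₁] where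
  /-- the embedding of `A₀` -/
  i₀ : A₀ →ₗ[ℝ] V
  /-- the embedding of `A₁` -/
  i₁ : A₁ →ₗ[ℝ] V
  injective₀ : Function.Injective i₀
  injective₁ : Function.Injective i₁
  compatible : IsClosed {p : A₀ × A₁ | i₀ p.1 = i₁ p.2}

namespace BanachCouple

section Couple

variable {V A₀ A₁ : Type*} [AddCommGroup V] [Module ℝ V]
  [NormedAddCommGroup A₀] [NormedSpace ℝ A₀] [CompleteSpace A₀]
  [NormedAddCommGroup A₁] [NormedSpace ℝ A₁] [CompleteSpace A₁]

/-- The sum space `A₀ + A₁`, as a subspace of the ambient space. -/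
def sum (A : BanachCouple V A₀ A₁) : Submodule ℝ V :=
  LinearMap.range A.i₀ ⊔ LinearMap.range A.i₁

/-- Peetre's `K`-functional `K(t, a; A)`, for `t > 0` and `a ∈ A₀ + A₁`.
The norm of `A₀ + A₁` is `K(1, ·; A)`. -/
noncomputable def K (A : BanachCouple V A₀ A₁) (t : ℝ) (a : V) : ℝ :=
  sInf {s : ℝ | ∃ (x : A₀) (y : A₁), A.i₀ x + A.i₁ y = a ∧ s = ‖x‖ + t * ‖y‖}

/-- `C` is an admissible constant for the `K`-divisibility of the couple (with infinitely many
terms): whenever `K(t, a) ≤ ∑ φₙ(t)` for all `t > 0`, where the `φₙ` are positive concave functions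
on `(0, ∞)` with `∑ φₙ(1) < ∞`, one can write `a = ∑ aₙ`, with convergence in the norm of `A₀ + A₁`,
such that `K(t, aₙ) ≤ C φₙ(t)` for all `t > 0` and all `n`. -/
def IsKDivisibilityBound (A : BanachCouple V A₀ A₁) (C : ℝ≥0) : Prop :=
  ∀ a ∈ A.sum, ∀ φ : ℕ → ℝ → ℝ,
    (∀ n, ConcaveOn ℝ (Ioi 0) (φ n)) → (∀ n, ∀ t : ℝ, 0 < t → 0 < φ n t) →
    Summable (fun n => φ n 1) →
    (∀ t : ℝ, 0 < t → A.K t a ≤ ∑' n, φ n t) →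
    ∃ u : ℕ → V, (∀ n, u n ∈ A.sum) ∧
      Tendsto (fun N => A.K 1 (a - ∑ n ∈ Finset.range N, u n)) atTop (𝓝 0) ∧
      ∀ n, ∀ t : ℝ, 0 < t → A.K t (u n) ≤ C * φ n t

/-- The `K`-divisibility constant `γ(A)`: the infimum of the admissible constants
(equal to `∞` if there is none). -/
noncomputable def gamma (A : BanachCouple V A₀ A₁) : ℝ≥0∞ :=
  ⨅ (C : ℝ≥0) (_ : A.IsKDivisibilityBound C), (C : ℝ≥0∞)

end Couple

section Operators

variable {V A₀ A₁ W B₀ B₁ : Type*} [AddCommGroup V] [Module ℝ V]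
  [NormedAddCommGroup A₀] [NormedSpace ℝ A₀] [CompleteSpace A₀]
  [NormedAddCommGroup A₁] [NormedSpace ℝ A₁] [CompleteSpace A₁]
  [AddCommGroup W] [Module ℝ W]
  [NormedAddCommGroup B₀] [NormedSpace ℝ B₀] [CompleteSpace B₀]
  [NormedAddCommGroup B₁] [NormedSpace ℝ B₁] [CompleteSpace B₁]

/-- A bounded linear operator `T : A → B` between Banach couples, given by its two restrictions
`Aⱼ → Bⱼ`, which have to agree on `A₀ ∩ A₁`. -/
structure Operator (A : BanachCouple V A₀ A₁) (B : BanachCouple W B₀ B₁) where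
  /-- the restriction to `A₀` -/
  T₀ : A₀ →L[ℝ] B₀
  /-- the restriction to `A₁` -/
  T₁ : A₁ →L[ℝ] B₁
  agree : ∀ x y, A.i₀ x = A.i₁ y → B.i₀ (T₀ x) = B.i₁ (T₁ y)

/-- The norm `‖T‖_{A → B}`, the larger of the norms of the two restrictions. -/
noncomputable def Operator.norm {A : BanachCouple V A₀ A₁} {B : BanachCouple W B₀ B₁}
    (T : Operator A B) : ℝ :=
  max ‖T.T₀‖ ‖T.T₁‖

/-- `T f = a`, where `f ∈ A₀ + A₁`. -/
def Operator.Maps {A : BanachCouple V A₀ A₁} {B : BanachCouple W B₀ B₁}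
    (T : Operator A B) (f : V) (a : W) : Prop :=
  ∃ x y, A.i₀ x + A.i₁ y = f ∧ B.i₀ (T.T₀ x) + B.i₁ (T.T₁ y) = a

/-- The infimum of `‖T‖_{A → B}` over all bounded operators `T` with `T f = a`
(equal to `∞` if there is none). -/
noncomputable def minNorm (A : BanachCouple V A₀ A₁) (B : BanachCouple W B₀ B₁)
    (f : V) (a : W) : ℝ≥0∞ :=
  ⨅ (T : Operator A B) (_ : T.Maps f a), ENNReal.ofReal T.norm

end Operators

end BanachCouple

/-! ### Couples of weighted `L¹` spaces -/

section WeightedL1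

variable {Ω : Type*} [MeasurableSpace Ω]

/-- The measure `w dμ`, so that `Lp ℝ 1 (weighted μ w)` is the weighted space `L¹_w(μ)`. -/
noncomputable def weighted (μ : Measure Ω) (w : Ω → ℝ) : Measure Ω :=
  μ.withDensity (fun s => ENNReal.ofReal (w s))

theorem ac_weighted {μ : Measure Ω} {w : Ω → ℝ} (hm : Measurable w) (hp : ∀ᵐ s ∂μ, 0 < w s) :
    μ ≪ weighted μ w := by
  refine withDensity_absolutelyContinuous' hm.ennreal_ofReal.aemeasurable ?_
  filter_upwards [hp] with s hs
  simpa using hs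

/-- The inclusion of `L¹_w(μ)` in the space of `μ`-a.e. equivalence classes of functions. -/
noncomputable def weightedIncl (μ : Measure Ω) (w : Ω → ℝ) (h : μ ≪ weighted μ w) :
    Lp ℝ 1 (weighted μ w) →ₗ[ℝ] (Ω →ₘ[μ] ℝ) where
  toFun x := AEEqFun.mk x (AEStronglyMeasurable.mono_ac h (Lp.aestronglyMeasurable x))
  map_add' x y := by
    rw [AEEqFun.mk_add_mk]
    exact AEEqFun.mk_eq_mk.2 (h.ae_le (Lp.coeFn_add x y))
  map_smul' c x := by
    rw [RingHom.id_apply, AEEqFun.smul_mk]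
    exact AEEqFun.mk_eq_mk.2 (h.ae_le (Lp.coeFn_smul c x))

theorem weightedIncl_injective (μ : Measure Ω) (w : Ω → ℝ) (h : μ ≪ weighted μ w) :
    Function.Injective (weightedIncl μ w h) := by
  intro x y hxy
  have h1 := AEEqFun.mk_eq_mk.1 hxy
  exact Lp.ext ((withDensity_absolutelyContinuous μ _).ae_le h1)

theorem weightedIncl_closed (μ : Measure Ω) (w₀ w₁ : Ω → ℝ) (h₀ : μ ≪ weighted μ w₀)
    (h₁ : μ ≪ weighted μ w₁) :
    IsClosed {p : Lp ℝ 1 (weighted μ w₀) × Lp ℝ 1 (weighted μ w₁) |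
      weightedIncl μ w₀ h₀ p.1 = weightedIncl μ w₁ h₁ p.2} := by
  refine IsSeqClosed.isClosed fun p q hp hpq => ?_
  have e₀ : Tendsto (fun n => (p n).1) atTop (𝓝 q.1) :=
    (continuous_fst.tendsto q).comp hpq
  have e₁ : Tendsto (fun n => (p n).2) atTop (𝓝 q.2) :=
    (continuous_snd.tendsto q).comp hpq
  obtain ⟨k, hk, hk'⟩ := (tendstoInMeasure_of_tendsto_Lp e₀).exists_seq_tendsto_ae
  obtain ⟨l, hl, hl'⟩ := (tendstoInMeasure_of_tendsto_Lp
    (e₁.comp hk.tendsto_atTop)).exists_seq_tendsto_ae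
  refine AEEqFun.mk_eq_mk.2 ?_
  have hall : ∀ᵐ s ∂μ, ∀ n, (p n).1 s = (p n).2 s :=
    ae_all_iff.2 fun n => AEEqFun.mk_eq_mk.1 (hp n)
  filter_upwards [h₀.ae_le hk', h₁.ae_le hl', hall] with s a₀ a₁ a₂
  refine tendsto_nhds_unique (a₀.comp hl.tendsto_atTop) ?_
  refine a₁.congr fun n => ?_
  exact (a₂ _).symm

/-- The couple `(L¹_{w₀}(μ), L¹_{w₁}(μ))`, for a.e. positive (finite) weights. -/
noncomputable def weightedL1Couple (μ : Measure Ω) (w₀ w₁ : Ω → ℝ)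
    (hm₀ : Measurable w₀) (hm₁ : Measurable w₁)
    (hp₀ : ∀ᵐ s ∂μ, 0 < w₀ s) (hp₁ : ∀ᵐ s ∂μ, 0 < w₁ s) :
    BanachCouple (Ω →ₘ[μ] ℝ) (Lp ℝ 1 (weighted μ w₀)) (Lp ℝ 1 (weighted μ w₁)) where
  i₀ := weightedIncl μ w₀ (ac_weighted hm₀ hp₀)
  i₁ := weightedIncl μ w₁ (ac_weighted hm₁ hp₁)
  injective₀ := weightedIncl_injective _ _ _
  injective₁ := weightedIncl_injective _ _ _
  compatible := weightedIncl_closed _ _ _ _ _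

end WeightedL1

/-! ### The couple `G = (ℓ₂², weighted ℓ₂²)` on `ℝ²` -/

/-- `ℝ²` with the norm `‖(x, y)‖ = √(x² + r y²)` (see `WeightedPlane.norm_eq`), `r > 0`. -/
def WeightedPlane (r : ℝ) [Fact (0 < r)] : Type := Fin 2 → ℝ

namespace WeightedPlane

noncomputable instance (r : ℝ) [Fact (0 < r)] : AddCommGroup (WeightedPlane r) :=
  inferInstanceAs (AddCommGroup (Fin 2 → ℝ))

noncomputable instance (r : ℝ) [Fact (0 < r)] : Module ℝ (WeightedPlane r) :=
  inferInstanceAs (Module ℝ (Fin 2 → ℝ))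

/-- The identity map from the weighted plane to `ℝ²`. -/
noncomputable def toFun (r : ℝ) [Fact (0 < r)] : WeightedPlane r ≃ₗ[ℝ] (Fin 2 → ℝ) :=
  LinearEquiv.refl ℝ (Fin 2 → ℝ)

/-- The map `(x, y) ↦ (x, √r y)` to the Euclidean plane. -/
noncomputable def toEuclidean (r : ℝ) [Fact (0 < r)] :
    WeightedPlane r →ₗ[ℝ] EuclideanSpace ℝ (Fin 2) where
  toFun p := !₂[toFun r p 0, √r * toFun r p 1]
  map_add' p q := by
    ext i; fin_cases i <;> simp [mul_add]
  map_smul' c p := by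
    ext i; fin_cases i <;> simp [mul_left_comm]

theorem toEuclidean_injective (r : ℝ) [h : Fact (0 < r)] :
    Function.Injective (toEuclidean r) := by
  intro p q hpq
  have hr : √r ≠ 0 := (Real.sqrt_pos.2 h.out).ne'
  have h0 := congrArg (fun v : EuclideanSpace ℝ (Fin 2) => v 0) hpq
  have h1 := congrArg (fun v : EuclideanSpace ℝ (Fin 2) => v 1) hpq
  refine (toFun r).injective ?_
  ext i
  fin_cases i
  · simpa [toEuclidean] using h0
  · simpa [toEuclidean, hr] using h1

noncomputable instance (r : ℝ) [Fact (0 < r)] : NormedAddCommGroup (WeightedPlane r) :=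
  NormedAddCommGroup.induced (WeightedPlane r) (EuclideanSpace ℝ (Fin 2)) (toEuclidean r)
    (toEuclidean_injective r)

noncomputable instance (r : ℝ) [Fact (0 < r)] : NormedSpace ℝ (WeightedPlane r) :=
  NormedSpace.induced ℝ (WeightedPlane r) (EuclideanSpace ℝ (Fin 2)) (toEuclidean r)

theorem norm_eq (r : ℝ) [h : Fact (0 < r)] (p : WeightedPlane r) :
    ‖p‖ = √((toFun r p 0) ^ 2 + r * (toFun r p 1) ^ 2) := by
  change ‖toEuclidean r p‖ = _
  rw [EuclideanSpace.norm_eq]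
  simp [toEuclidean, mul_pow, Real.sq_sqrt h.out.le]

instance (r : ℝ) [Fact (0 < r)] : FiniteDimensional ℝ (WeightedPlane r) :=
  FiniteDimensional.of_injective (toFun r).toLinearMap (toFun r).injective

instance (r : ℝ) [Fact (0 < r)] : CompleteSpace (WeightedPlane r) :=
  FiniteDimensional.complete ℝ (WeightedPlane r)

end WeightedPlane

/-- The couple `G = (G₀, G₁)` on `ℝ²`, where `G₀` has the Euclidean norm and `G₁` the norm
`√(x² + r y²)`. -/
noncomputable def coupleG (r : ℝ) [Fact (0 < r)] :
    BanachCouple (Fin 2 → ℝ) (EuclideanSpace ℝ (Fin 2)) (WeightedPlane r) where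
  i₀ := (WithLp.linearEquiv 2 ℝ (Fin 2 → ℝ)).toLinearMap
  i₁ := (WeightedPlane.toFun r).toLinearMap
  injective₀ := LinearEquiv.injective _
  injective₁ := LinearEquiv.injective _
  compatible := by
    refine isClosed_eq ?_ ?_
    · exact (LinearMap.continuous_of_finiteDimensional _).comp continuous_fst
    · exact (LinearMap.continuous_of_finiteDimensional _).comp continuous_snd

/-! ### The `L¹` couple attached to the point `α = (cos a, sin a)` -/

/-- First coordinate of the parametrized boundary of the Gagliardo diagram of
`α = (b, c) = (cos a, sin a)` with respect to `G`. -/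
noncomputable def gamma₀ (r a t : ℝ) : ℝ :=
  t * √((Real.cos a) ^ 2 / (1 + t) ^ 2 + r ^ 2 * (Real.sin a) ^ 2 / (1 + t * r) ^ 2)

/-- Second coordinate of the parametrized boundary of the Gagliardo diagram of `α`. -/
noncomputable def gamma₁ (r a t : ℝ) : ℝ :=
  √((Real.cos a) ^ 2 / (1 + t) ^ 2 + r * (Real.sin a) ^ 2 / (1 + t * r) ^ 2)

/-- The weight `w₀ = γ₀'`. -/
noncomputable def weight₀ (r a : ℝ) : ℝ → ℝ := deriv (gamma₀ r a)

/-- The weight `w₁ = -γ₁'`. -/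
noncomputable def weight₁ (r a : ℝ) : ℝ → ℝ := fun t => -deriv (gamma₁ r a) t

theorem radicand_pos {r q : ℝ} (hr : 0 < r) (hq : 0 < q) (a : ℝ) {t : ℝ} (ht : 0 < t) (m : ℕ) :
    0 < (Real.cos a) ^ 2 / (1 + t) ^ m + q * (Real.sin a) ^ 2 / (1 + t * r) ^ m := by
  have h := Real.sin_sq_add_cos_sq a
  rcases eq_or_ne (Real.sin a) 0 with hs | hs
  · have : (Real.cos a) ^ 2 = 1 := by simpa [hs] using h
    rw [hs, this]
    positivity
  · have : 0 < (Real.sin a) ^ 2 := by positivity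
    positivity

theorem hasDerivAt_radicand {r : ℝ} (hr : 0 < r) (q a : ℝ) {t : ℝ} (ht : 0 < t) :
    HasDerivAt (fun t => (Real.cos a) ^ 2 / (1 + t) ^ 2 + q * (Real.sin a) ^ 2 / (1 + t * r) ^ 2)
      (-2 * ((Real.cos a) ^ 2 / (1 + t) ^ 3 + q * r * (Real.sin a) ^ 2 / (1 + t * r) ^ 3)) t := by
  have h1 : (1 + t) ≠ 0 := by positivity
  have h2 : (1 + t * r) ≠ 0 := by positivity
  have d1 : HasDerivAt (fun t : ℝ => (1 + t) ^ 2) (2 * (1 + t)) t := by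
    simpa using ((hasDerivAt_id t).const_add 1).fun_pow 2
  have d2 : HasDerivAt (fun t : ℝ => (1 + t * r) ^ 2) (2 * (1 + t * r) * r) t := by
    simpa using (((hasDerivAt_id t).mul_const r).const_add 1).fun_pow 2
  have := ((hasDerivAt_const t ((Real.cos a) ^ 2)).fun_div d1 (pow_ne_zero 2 h1)).fun_add
    ((hasDerivAt_const t (q * (Real.sin a) ^ 2)).fun_div d2 (pow_ne_zero 2 h2))
  refine this.congr_deriv ?_
  field_simp
  ring

theorem weight₀_pos {r : ℝ} (hr : 0 < r) (a : ℝ) {t : ℝ} (ht : 0 < t) : 0 < weight₀ r a t := by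
  have hq : 0 < r ^ 2 := by positivity
  have hR := radicand_pos hr hq a ht 2
  have h3 := radicand_pos hr hq a ht 3
  have hs := Real.sqrt_pos.2 hR
  have hd := (hasDerivAt_id t).mul ((hasDerivAt_radicand hr (r ^ 2) a ht).sqrt hR.ne')
  have he : weight₀ r a t = _ := hd.deriv
  rw [he]
  have h1 : (1 + t) ≠ 0 := by positivity
  have h2 : (1 + t * r) ≠ 0 := by positivity
  have key : (√((Real.cos a) ^ 2 / (1 + t) ^ 2 + r ^ 2 * (Real.sin a) ^ 2 / (1 + t * r) ^ 2)) ^ 2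
      - t * ((Real.cos a) ^ 2 / (1 + t) ^ 3 + r ^ 2 * r * (Real.sin a) ^ 2 / (1 + t * r) ^ 3)
      = (Real.cos a) ^ 2 / (1 + t) ^ 3 + r ^ 2 * (Real.sin a) ^ 2 / (1 + t * r) ^ 3 := by
    rw [Real.sq_sqrt hR.le]
    field_simp
    ring
  have : 0 < ((√((Real.cos a) ^ 2 / (1 + t) ^ 2
      + r ^ 2 * (Real.sin a) ^ 2 / (1 + t * r) ^ 2)) ^ 2
      - t * ((Real.cos a) ^ 2 / (1 + t) ^ 3 + r ^ 2 * r * (Real.sin a) ^ 2 / (1 + t * r) ^ 3))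
      / √((Real.cos a) ^ 2 / (1 + t) ^ 2 + r ^ 2 * (Real.sin a) ^ 2 / (1 + t * r) ^ 2) :=
    div_pos (key ▸ h3) hs
  convert this using 1
  simp only [id]
  generalize √((Real.cos a) ^ 2 / (1 + t) ^ 2
    + r ^ 2 * (Real.sin a) ^ 2 / (1 + t * r) ^ 2) = S at hs
  have := hs.ne'
  field_simp
  ring

theorem weight₁_pos {r : ℝ} (hr : 0 < r) (a : ℝ) {t : ℝ} (ht : 0 < t) : 0 < weight₁ r a t := by
  have hR := radicand_pos hr hr a ht 2
  have h3 := radicand_pos hr (mul_pos hr hr) a ht 3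
  have hs := Real.sqrt_pos.2 hR
  have hd := (hasDerivAt_radicand hr r a ht).sqrt hR.ne'
  have he : deriv (gamma₁ r a) t = _ := hd.deriv
  rw [weight₁, he, ← neg_div]
  exact div_pos (by linarith) (by positivity)

/-- The couple `P = (L¹_{w₀}, L¹_{w₁})` on `(0, ∞)` with Lebesgue measure, where
`w₀ = γ₀'` and `w₁ = -γ₁'`. -/
noncomputable def coupleP (r a : ℝ) [h : Fact (0 < r)] :
    BanachCouple (ℝ →ₘ[volume.restrict (Ioi (0 : ℝ))] ℝ)
      (Lp ℝ 1 (weighted (volume.restrict (Ioi (0 : ℝ))) (weight₀ r a)))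
      (Lp ℝ 1 (weighted (volume.restrict (Ioi (0 : ℝ))) (weight₁ r a))) :=
  weightedL1Couple (volume.restrict (Ioi (0 : ℝ))) (weight₀ r a) (weight₁ r a)
    (measurable_deriv _) (measurable_deriv _).neg
    ((ae_restrict_mem measurableSet_Ioi).mono fun _ ht => weight₀_pos h.out a ht)
    ((ae_restrict_mem measurableSet_Ioi).mono fun _ ht => weight₁_pos h.out a ht)

/-- The quantity `c_a = c_a(G)`: the infimum of `‖T‖_{P → G}` over all bounded operators
`T : P → G` that map the constant function `1` to `α = (cos a, sin a)`. -/
noncomputable def cConst (r a : ℝ) [Fact (0 < r)] : ℝ≥0∞ :=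
  BanachCouple.minNorm (coupleP r a) (coupleG r)
    (AEEqFun.const ℝ (1 : ℝ)) ![Real.cos a, Real.sin a]

/-! Write `s` and `t` for the minimum and maximum of `1` and `1/√r`. The ratio of the two norms of
`G` stays in `[s, t]`, so a vector enters only through its pair of norms `(x, y)`, a point of the
plane cone `s y ≤ x ≤ t y`. The whole proof rests on one linear map `(x, y) ↦ x e + y e'` that sends
the norm pair of a given vector to that vector and is bounded by some `C` on the cone (`ConeBound`).
One coordinate of the image is driven by `x`, the other by `y`; which one depends on whether `r ≥ 1`
or `r ≤ 1`. This gives the explicit constants of `coneBound_of_one_le` and `coneBound_of_le_one`.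

For `c_a`: the pair `(w₀, w₁)` lies pointwise in the cone, and its integral is the norm pair of `α`.
Hence `f ↦ (∫ f w₀) e + (∫ f w₁) e'` maps `1` to `α` with norm at most `C`. The constant is `1` at
the two endpoints, where `c_a ≥ 1` follows from `∫ w₀ = ‖α‖_{G₀} = 1`.

For `γ(G)`: only the values of `φₙ` at `s` and `t` matter. Concavity puts the pairs `(φₙ s, φₙ t)`
in a cone, where a Riesz decomposition (`exists_hasSum_of_le_tsum`) splits the norm pair of `a` into
pairs dominated by them; the linear map turns these into the `aₙ`. The constants satisfy `C² ≤ 2 -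
1/r` or `C² ≤ 2 - r` uniformly in `a`, and this uniformity gives the strict inequality for the
infimum. -/

/-! ### Positive concave functions on the half-line. -/

/-- After a drop of slope `-d` between `u` and `v`, concavity forces at least this descent onwards,
so `φ` would be nonpositive at `v + φ v / d`. -/
theorem ConcaveOn.le_of_pos_Ioi {φ : ℝ → ℝ} (hφ : ConcaveOn ℝ (Ioi 0) φ)
    (hpos : ∀ t : ℝ, 0 < t → 0 < φ t)
    {u v : ℝ} (hu : 0 < u) (huv : u ≤ v) : φ u ≤ φ v := by
  rcases huv.eq_or_lt with rfl | huv
  · exact le_rfl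
  by_contra! h
  have hv : 0 < v := hu.trans huv
  have hd : 0 < (φ u - φ v) / (v - u) := div_pos (by linarith) (by linarith)
  set d := (φ u - φ v) / (v - u) with hd'
  have hw : 0 < φ v / d := div_pos (hpos v hv) hd
  have hs := hφ.slope_anti_adjacent (x := u) (y := v) (z := v + φ v / d) hu
    (by simp only [mem_Ioi]; linarith) huv (by linarith)
  have h1 : (φ v - φ u) / (v - u) = -d := by rw [hd', ← neg_div]; congr 1; ring
  rw [h1, add_sub_cancel_left, div_le_iff₀ hw] at hs
  have h2 : -d * (φ v / d) = -φ v := by field_simp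
  have := hpos (v + φ v / d) (by linarith)
  linarith

theorem ConcaveOn.mul_le_mul_of_pos_Ioi {φ : ℝ → ℝ} (hφ : ConcaveOn ℝ (Ioi 0) φ)
    (hpos : ∀ t : ℝ, 0 < t → 0 < φ t)
    {u v : ℝ} (hu : 0 < u) (huv : u ≤ v) :
    u * φ v ≤ v * φ u := by
  rcases huv.eq_or_lt with rfl | huv
  · exact le_rfl
  by_contra! h
  have hv : 0 < v := hu.trans huv
  have hpu := hpos u hu
  have hpv := hpos v hv
  -- A positive point to the left of the zero of the chord through `u` and `v`; by concavity `φ`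
  -- lies below the extended chord there, hence would be negative.
  set ε := (u * φ v - v * φ u) / (2 * φ v) with hε
  have hε0 : 0 < ε := div_pos (by linarith) (by linarith)
  have hεu : ε < u := by
    rw [hε, div_lt_iff₀ (by linarith)]
    nlinarith [mul_pos hv hpu, mul_pos hu hpv]
  have hs := hφ.slope_anti_adjacent (x := ε) (y := u) (z := v) hε0 hv hεu huv
  rw [div_le_div_iff₀ (by linarith) (by linarith)] at hs
  have he : ε * (2 * φ v) = u * φ v - v * φ u := by rw [hε]; field_simp
  nlinarith [mul_pos (sub_pos.2 huv) (hpos ε hε0), mul_pos hε0 hpu]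

theorem ConcaveOn.affine_le_of_mem_Icc {φ : ℝ → ℝ} (hφ : ConcaveOn ℝ (Ioi 0) φ)
    {s t τ m k : ℝ} (hs : 0 < s) (h1 : s ≤ τ) (h2 : τ ≤ t)
    (hms : m + s * k ≤ φ s) (hmt : m + t * k ≤ φ t) : m + τ * k ≤ φ τ := by
  rcases (h1.trans h2).eq_or_lt with rfl | hst
  · obtain rfl : τ = s := le_antisymm h2 h1
    exact hms
  have h3 : 0 < t - s := sub_pos.2 hst
  have h := hφ.2 (mem_Ioi.2 hs) (mem_Ioi.2 (hs.trans hst))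
    (div_nonneg (by linarith) h3.le : 0 ≤ (t - τ) / (t - s))
    (div_nonneg (by linarith) h3.le : 0 ≤ (τ - s) / (t - s)) (by field_simp; ring)
  have h4 : ((t - τ) / (t - s)) • s + ((τ - s) / (t - s)) • t = τ := by
    simp only [smul_eq_mul]; field_simp; ring
  rw [h4] at h
  refine le_trans ?_ h
  have h5 : m + τ * k = (t - τ) / (t - s) * (m + s * k) + (τ - s) / (t - s) * (m + t * k) := by
    field_simp; ring
  rw [h5, smul_eq_mul, smul_eq_mul]
  gcongr

/-! ### Countable Riesz decomposition in a plane cone. -/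

/-- Riesz decomposition, with countably many terms, in the cone `κ x ≤ z ≤ x` of the plane ordered
coordinatewise. -/
theorem exists_hasSum_of_le_tsum {p q : ℕ → ℝ} {κ Z X : ℝ} (hκ : 0 < κ)
    (hp : Summable p) (hq : Summable q) (hp0 : ∀ n, 0 < p n)
    (hqp : ∀ n, κ * q n ≤ p n) (hpq : ∀ n, p n ≤ q n)
    (hX : 0 ≤ X) (hXZ : κ * X ≤ Z) (hZX : Z ≤ X) (hZ' : Z ≤ ∑' n, p n) (hX' : X ≤ ∑' n, q n) :
    ∃ z x : ℕ → ℝ, HasSum z Z ∧ HasSum x X ∧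
      ∀ n, 0 ≤ z n ∧ z n ≤ p n ∧ x n ≤ q n ∧ κ * x n ≤ z n ∧ z n ≤ x n := by
  have hP : 0 < ∑' n, p n := hp.tsum_pos (fun n => (hp0 n).le) 0 (hp0 0)
  have hPQ : ∑' n, p n ≤ ∑' n, q n := hp.tsum_le_tsum hpq hq
  have hSp := hp.hasSum
  have hSq := hq.hasSum
  have hκPQ : κ * ∑' n, q n ≤ ∑' n, p n := by
    rw [← tsum_mul_left]
    exact (hq.mul_left κ).tsum_le_tsum hqp hp
  set P := ∑' n, p n
  set Q := ∑' n, q n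
  have hQ : 0 < Q := hP.trans_le hPQ
  have hZ : 0 ≤ Z := (mul_nonneg hκ.le hX).trans hXZ
  rcases le_total (X * P) (Z * Q) with h | h
  · -- scale by `Z / P`, then lower the second coordinate
    have hc0 : 0 ≤ Z / P := div_nonneg hZ hP.le
    have hc1 : Z / P ≤ 1 := (div_le_one hP).2 hZ'
    have hcP : Z / P * P = Z := by field_simp
    have hcQ : X ≤ Z / P * Q := by
      rw [div_mul_eq_mul_div, le_div_iff₀ hP]; exact h
    -- After scaling, the second total is too large. Sliding each second coordinate from `c q n`
    -- towards `c p n` by a common fraction stays in the cone and reaches the total `X`; if the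
    -- interval degenerates, any `θ` works.
    obtain ⟨θ, hθ0, hθ1, hθ⟩ : ∃ θ : ℝ, 0 ≤ θ ∧ θ ≤ 1 ∧ Z + θ * (Z / P * Q - Z) = X := by
      rcases (hZX.trans hcQ).eq_or_lt with h0 | h0
      · exact ⟨0, le_rfl, zero_le_one, by linarith⟩
      · refine ⟨(X - Z) / (Z / P * Q - Z), div_nonneg (by linarith) (by linarith),
          (div_le_one (by linarith)).2 (by linarith), ?_⟩
        rw [div_mul_cancel₀ _ (by linarith)]; ring
    set c := Z / P
    refine ⟨fun n => c * p n, fun n => c * p n + θ * (c * q n - c * p n), ?_, ?_, fun n => ?_⟩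
    · simpa only [hcP] using hSp.mul_left c
    · have := (hSp.mul_left c).add (((hSq.mul_left c).sub (hSp.mul_left c)).mul_left θ)
      simpa only [hcP, hθ] using this
    · have h1 : c * p n ≤ c * q n := mul_le_mul_of_nonneg_left (hpq n) hc0
      have h2 : c * (κ * q n) ≤ c * p n := mul_le_mul_of_nonneg_left (hqp n) hc0
      have h3 : θ * (c * q n - c * p n) ≤ 1 * (c * q n - c * p n) :=
        mul_le_mul_of_nonneg_right hθ1 (by linarith)
      have h4 : 0 ≤ θ * (c * q n - c * p n) := mul_nonneg hθ0 (by linarith)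
      have h5 : c * p n ≤ 1 * p n := mul_le_mul_of_nonneg_right hc1 (hp0 n).le
      have h6 : c * q n ≤ 1 * q n :=
        mul_le_mul_of_nonneg_right hc1 ((hp0 n).le.trans (hpq n))
      have h7 : κ * (c * p n + θ * (c * q n - c * p n)) ≤ κ * (c * q n) :=
        mul_le_mul_of_nonneg_left (by linarith) hκ.le
      exact ⟨mul_nonneg hc0 (hp0 n).le, by linarith, by linarith, by linarith, by linarith⟩
  · -- scale by `X / Q`, then lower the first coordinate
    have hc0 : 0 ≤ X / Q := div_nonneg hX hQ.le
    have hc1 : X / Q ≤ 1 := (div_le_one hQ).2 hX'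
    have hcQ : X / Q * Q = X := by field_simp
    have hcP : Z ≤ X / Q * P := by
      rw [div_mul_eq_mul_div, le_div_iff₀ hQ]; exact h
    -- Here the first coordinates slide from `c p n` towards the other edge of the cone, `κ c q n`.
    obtain ⟨θ, hθ0, hθ1, hθ⟩ :
        ∃ θ : ℝ, 0 ≤ θ ∧ θ ≤ 1 ∧ κ * X + θ * (X / Q * P - κ * X) = Z := by
      rcases (hXZ.trans hcP).eq_or_lt with h0 | h0
      · exact ⟨0, le_rfl, zero_le_one, by linarith⟩
      · refine ⟨(Z - κ * X) / (X / Q * P - κ * X), div_nonneg (by linarith) (by linarith),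
          (div_le_one (by linarith)).2 (by linarith), ?_⟩
        rw [div_mul_cancel₀ _ (by linarith)]; ring
    set c := X / Q
    refine ⟨fun n => κ * (c * q n) + θ * (c * p n - κ * (c * q n)), fun n => c * q n,
      ?_, ?_, fun n => ?_⟩
    · have := ((hSq.mul_left c).mul_left κ).add
        (((hSp.mul_left c).sub ((hSq.mul_left c).mul_left κ)).mul_left θ)
      simpa only [hcQ, hθ] using this
    · simpa only [hcQ] using hSq.mul_left c
    · have h1 : c * p n ≤ c * q n := mul_le_mul_of_nonneg_left (hpq n) hc0
      have h2 : κ * (c * q n) ≤ c * p n := by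
        have := mul_le_mul_of_nonneg_left (hqp n) hc0
        linarith
      have h3 : θ * (c * p n - κ * (c * q n)) ≤ 1 * (c * p n - κ * (c * q n)) :=
        mul_le_mul_of_nonneg_right hθ1 (by linarith)
      have h4 : 0 ≤ θ * (c * p n - κ * (c * q n)) := mul_nonneg hθ0 (by linarith)
      have h5 : c * p n ≤ 1 * p n := mul_le_mul_of_nonneg_right hc1 (hp0 n).le
      have hq0 := (hp0 n).le.trans (hpq n)
      have h6 : c * q n ≤ 1 * q n := mul_le_mul_of_nonneg_right hc1 hq0
      have h7 : 0 ≤ κ * (c * q n) := mul_nonneg hκ.le (mul_nonneg hc0 hq0)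
      exact ⟨by linarith, by linarith, by linarith, by linarith, by linarith⟩

/-! ### The norms of `G` on a common plane, and the `K`-functional. -/

/-- The norm `√(x² + r y²)` on the plane. -/
noncomputable def planeNorm (r : ℝ) (v : Fin 2 → ℝ) : ℝ := √((v 0) ^ 2 + r * (v 1) ^ 2)

theorem planeNorm_nonneg (r : ℝ) (v : Fin 2 → ℝ) : 0 ≤ planeNorm r v := Real.sqrt_nonneg _

theorem planeNorm_sq {r : ℝ} (hr : 0 ≤ r) (v : Fin 2 → ℝ) :
    planeNorm r v ^ 2 = (v 0) ^ 2 + r * (v 1) ^ 2 :=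
  Real.sq_sqrt (by positivity)

theorem norm_toLp_eq_planeNorm (v : Fin 2 → ℝ) : ‖WithLp.toLp 2 v‖ = planeNorm 1 v := by
  simp [EuclideanSpace.norm_eq, planeNorm]

theorem norm_toFun_symm_eq_planeNorm (r : ℝ) [Fact (0 < r)] (v : Fin 2 → ℝ) :
    ‖(WeightedPlane.toFun r).symm v‖ = planeNorm r v := by
  simp [WeightedPlane.norm_eq, planeNorm]

theorem planeNorm_add_le {r : ℝ} (hr : 0 < r) (v w : Fin 2 → ℝ) :
    planeNorm r (v + w) ≤ planeNorm r v + planeNorm r w := by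
  have : Fact (0 < r) := ⟨hr⟩
  simp only [← norm_toFun_symm_eq_planeNorm, map_add]
  exact norm_add_le _ _

theorem planeNorm_le_mul {r : ℝ} {v : Fin 2 → ℝ} {c : ℝ} (hc : 0 ≤ c)
    (h : (v 0) ^ 2 + r * (v 1) ^ 2 ≤ c ^ 2) : planeNorm r v ≤ c :=
  (Real.sqrt_le_sqrt h).trans_eq (Real.sqrt_sq hc)

section coupleG

variable (r : ℝ) [Fact (0 < r)]

theorem coupleG_sum_eq_top : (coupleG r).sum = ⊤ := by
  refine top_unique fun v _ => Submodule.mem_sup_left ?_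
  exact ⟨WithLp.toLp 2 v, rfl⟩

theorem bddBelow_coupleG_K {τ : ℝ} (hτ : 0 ≤ τ) (v : Fin 2 → ℝ) :
    BddBelow {s : ℝ | ∃ (x : EuclideanSpace ℝ (Fin 2)) (y : WeightedPlane r),
      (coupleG r).i₀ x + (coupleG r).i₁ y = v ∧ s = ‖x‖ + τ * ‖y‖} := by
  refine ⟨0, ?_⟩
  rintro _ ⟨x, y, _, rfl⟩
  positivity

theorem coupleG_K_nonneg {τ : ℝ} (hτ : 0 ≤ τ) (v : Fin 2 → ℝ) : 0 ≤ (coupleG r).K τ v := by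
  refine Real.sInf_nonneg ?_
  rintro _ ⟨x, y, _, rfl⟩
  positivity

theorem coupleG_K_add_le {τ : ℝ} (hτ : 0 ≤ τ) (v w : Fin 2 → ℝ) :
    (coupleG r).K τ (v + w) ≤ planeNorm 1 v + τ * planeNorm r w := by
  refine csInf_le (bddBelow_coupleG_K r hτ _)
    ⟨WithLp.toLp 2 v, (WeightedPlane.toFun r).symm w, ?_, ?_⟩
  · simp [coupleG]
  · rw [norm_toLp_eq_planeNorm, norm_toFun_symm_eq_planeNorm]

theorem le_coupleG_K {τ c : ℝ} {a : Fin 2 → ℝ}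
    (h : ∀ v w : Fin 2 → ℝ, v + w = a → c ≤ planeNorm 1 v + τ * planeNorm r w) :
    c ≤ (coupleG r).K τ a := by
  refine le_csInf ⟨_, WithLp.toLp 2 a, 0, ?_, rfl⟩ ?_
  · simp [coupleG]
  · rintro _ ⟨x, y, hxy, rfl⟩
    have h1 := h x.ofLp (WeightedPlane.toFun r y) hxy
    rw [← norm_toLp_eq_planeNorm, ← norm_toFun_symm_eq_planeNorm] at h1
    simpa using h1

theorem coupleG_K_le_planeNorm_one {τ : ℝ} (hτ : 0 ≤ τ) (v : Fin 2 → ℝ) :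
    (coupleG r).K τ v ≤ planeNorm 1 v := by
  simpa [planeNorm] using coupleG_K_add_le r hτ v 0

theorem coupleG_K_le_mul_planeNorm {τ : ℝ} (hτ : 0 ≤ τ) (v : Fin 2 → ℝ) :
    (coupleG r).K τ v ≤ τ * planeNorm r v := by
  simpa [planeNorm] using coupleG_K_add_le r hτ 0 v

end coupleG

/-! ### Linear maps from the cone of norm pairs to `G`. -/

/-- The linear map `(x, y) ↦ x e + y e'` maps the cone `s y ≤ x ≤ t y`, where `(x, y)` has the norms
`x` and `y`, to the couple `G` with norm at most `C`. -/
def ConeBound (r s t C : ℝ) (e e' : Fin 2 → ℝ) : Prop :=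
  ∀ x y : ℝ, 0 ≤ y → s * y ≤ x → x ≤ t * y →
    planeNorm 1 (x • e + y • e') ≤ C * x ∧ planeNorm r (x • e + y • e') ≤ C * y

/-- With `A`, `B` the nonzero entries of `e`, `e'`, the squared norms are `A²x² + B²y²` and `A²x² +
rB²y²`. The cone gives `y² ≤ r x²` for the first and `x² ≤ y²` for the second, and both lead to `A²
+ rB²`. -/
theorem coneBound_of_one_le {r : ℝ} (hr : 1 ≤ r) {a : Fin 2 → ℝ} :
    ConeBound r (√r)⁻¹ 1
      √((a 0 / planeNorm 1 a) ^ 2 + r * (a 1 / planeNorm r a) ^ 2)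
      ![a 0 / planeNorm 1 a, 0] ![0, a 1 / planeNorm r a] := by
  intro x y hy h1 h2
  have hr0 : 0 < r := by linarith
  have hs : 0 < √r := Real.sqrt_pos.2 hr0
  have hx : 0 ≤ x := (by positivity : 0 ≤ (√r)⁻¹ * y).trans h1
  have hyx : y ^ 2 ≤ r * x ^ 2 := by
    rw [inv_mul_le_iff₀ hs] at h1
    calc y ^ 2 ≤ (√r * x) ^ 2 := by gcongr
      _ = _ := by rw [mul_pow, Real.sq_sqrt hr0.le]
  have hxy : x ^ 2 ≤ y ^ 2 := by rw [one_mul] at h2; gcongr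
  generalize a 0 / planeNorm 1 a = A
  generalize a 1 / planeNorm r a = B
  constructor
  · refine planeNorm_le_mul (by positivity) ?_
    rw [mul_pow, Real.sq_sqrt (by positivity)]
    simp
    nlinarith [mul_le_mul_of_nonneg_left hyx (sq_nonneg B)]
  · refine planeNorm_le_mul (by positivity) ?_
    rw [mul_pow, Real.sq_sqrt (by positivity)]
    simp
    nlinarith [mul_le_mul_of_nonneg_left hxy (sq_nonneg A)]

/-- For `r ≤ 1` the cone is `y² ≤ x² ≤ y²/r`, so the roles of `x` and `y` are exchanged: the first
coordinate is now driven by `y`. -/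
theorem coneBound_of_le_one {r : ℝ} (hr0 : 0 < r) {a : Fin 2 → ℝ} :
    ConeBound r 1 (√r)⁻¹
      √((a 0 / planeNorm r a) ^ 2 + (a 1 / planeNorm 1 a) ^ 2)
      ![0, a 1 / planeNorm 1 a] ![a 0 / planeNorm r a, 0] := by
  intro x y hy h1 h2
  have hs : 0 < √r := Real.sqrt_pos.2 hr0
  have hx : 0 ≤ x := (by positivity : 0 ≤ 1 * y).trans h1
  have hyx : y ^ 2 ≤ x ^ 2 := by rw [one_mul] at h1; gcongr
  have hxy : r * x ^ 2 ≤ y ^ 2 := by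
    rw [← div_eq_inv_mul, le_div_iff₀ hs] at h2
    calc r * x ^ 2 = (x * √r) ^ 2 := by rw [mul_pow, Real.sq_sqrt hr0.le, mul_comm]
      _ ≤ _ := by gcongr
  generalize a 1 / planeNorm 1 a = B
  generalize a 0 / planeNorm r a = A
  constructor
  · refine planeNorm_le_mul (by positivity) ?_
    rw [mul_pow, Real.sq_sqrt (by positivity)]
    simp
    nlinarith [mul_le_mul_of_nonneg_left hyx (sq_nonneg A)]
  · refine planeNorm_le_mul (by positivity) ?_
    rw [mul_pow, Real.sq_sqrt (by positivity)]
    simp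
    nlinarith [mul_le_mul_of_nonneg_left hxy (sq_nonneg B)]

theorem ConeBound.mono {r s t C C' : ℝ} {e e' : Fin 2 → ℝ} (h : ConeBound r s t C e e')
    (hs : 0 < s) (hC : C ≤ C') : ConeBound r s t C' e e' := fun x y hy h1 h2 =>
  ⟨(h x y hy h1 h2).1.trans
      (mul_le_mul_of_nonneg_right hC ((mul_nonneg hs.le hy).trans h1)),
    (h x y hy h1 h2).2.trans (mul_le_mul_of_nonneg_right hC hy)⟩

/-! ### `K`-divisibility of `G`. -/

section coupleG

variable (r : ℝ) [Fact (0 < r)]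

/-- The pair is `m₀ (s, 1) + m₁ (t, 1)`, split along the extreme rays of the cone. For `s ≤ τ ≤ t`,
putting the first part in `G₀` and the second in `G₁` costs `C (m₀ s + τ m₁)`, affine in `τ` and
controlled at both ends, so concavity finishes. Outside `[s, t]` one norm alone suffices. -/
theorem coupleG_K_le_of_coneBound {s t C τ m₀ m₁ : ℝ} {e e' : Fin 2 → ℝ}
    (h : ConeBound r s t C e e') (hs : 0 < s) (hst : s ≤ t) (hC : 0 ≤ C) (hm₀ : 0 ≤ m₀)
    (hm₁ : 0 ≤ m₁) {φ : ℝ → ℝ} (hφ : ConcaveOn ℝ (Ioi 0) φ) (hpos : ∀ t : ℝ, 0 < t → 0 < φ t)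
    (hφs : s * (m₀ + m₁) ≤ φ s) (hφt : m₀ * s + m₁ * t ≤ φ t) (hτ : 0 < τ) :
    (coupleG r).K τ ((m₀ * s + m₁ * t) • e + (m₀ + m₁) • e') ≤ C * φ τ := by
  have hm₁s : m₁ * s ≤ m₁ * t := mul_le_mul_of_nonneg_left hst hm₁
  have hm₀s : m₀ * s ≤ m₀ * t := mul_le_mul_of_nonneg_left hst hm₀
  have hu := h (m₀ * s + m₁ * t) (m₀ + m₁) (by positivity) (by linarith) (by linarith)
  rcases le_total τ s with hτs | hsτ
  · refine (coupleG_K_le_mul_planeNorm r hτ.le _).trans ?_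
    calc τ * _ ≤ τ * (C * (m₀ + m₁)) := by gcongr; exact hu.2
      _ = C * (τ * (m₀ + m₁)) := by ring
      _ ≤ C * φ τ := by
        gcongr
        refine le_of_mul_le_mul_left ?_ hs
        calc s * (τ * (m₀ + m₁)) = τ * (s * (m₀ + m₁)) := by ring
          _ ≤ τ * φ s := by gcongr
          _ ≤ s * φ τ := hφ.mul_le_mul_of_pos_Ioi hpos hτ hτs
  rcases le_total t τ with htτ | hτt
  · refine (coupleG_K_le_planeNorm_one r hτ.le _).trans (hu.1.trans ?_)
    gcongr
    exact hφt.trans (hφ.le_of_pos_Ioi hpos (hs.trans_le hst) htτ)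
  · have h0 := h (m₀ * s) m₀ hm₀ (by linarith) (by linarith)
    have h1 := h (m₁ * t) m₁ hm₁ (by linarith) (by linarith)
    have hsplit : (m₀ * s + m₁ * t) • e + (m₀ + m₁) • e'
        = ((m₀ * s) • e + m₀ • e') + ((m₁ * t) • e + m₁ • e') := by
      simp only [add_smul]; abel
    rw [hsplit]
    refine (coupleG_K_add_le r hτ.le _ _).trans ?_
    calc _ ≤ C * (m₀ * s) + τ * (C * m₁) := by gcongr; exacts [h0.1, h1.2]
      _ = C * (m₀ * s + τ * m₁) := by ring
      _ ≤ C * φ τ := by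
        gcongr
        exact hφ.affine_le_of_mem_Icc hs hsτ hτt (by linarith) (by linarith)

theorem coupleG_isKDivisibilityBound {s t : ℝ} {C : ℝ≥0} (hs : 0 < s) (hst : s ≤ t)
    (h1 : ∀ v, s * planeNorm r v ≤ planeNorm 1 v) (h2 : ∀ v, planeNorm 1 v ≤ t * planeNorm r v)
    (H : ∀ a : Fin 2 → ℝ, ∃ e e' : Fin 2 → ℝ,
      planeNorm 1 a • e + planeNorm r a • e' = a ∧ ConeBound r s t C e e') :
    (coupleG r).IsKDivisibilityBound C := by
  intro a _ φ hφ hpos hsum hK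
  have ht : 0 < t := hs.trans_le hst
  obtain ⟨e, e', hea, he⟩ := H a
  have hsumτ : ∀ τ : ℝ, 0 < τ → Summable fun n => φ n τ := by
    intro τ hτ
    refine Summable.of_nonneg_of_le (fun n => (hpos n τ hτ).le) (fun n => ?_)
      (hsum.mul_left (max 1 τ))
    rcases le_total τ 1 with h | h
    · calc φ n τ ≤ 1 * φ n 1 := by
            rw [one_mul]; exact (hφ n).le_of_pos_Ioi (hpos n) hτ h
        _ ≤ _ := by have := (hpos n 1 one_pos).le; gcongr; exact le_max_left _ _
    · calc φ n τ = 1 * φ n τ := (one_mul _).symm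
        _ ≤ τ * φ n 1 := (hφ n).mul_le_mul_of_pos_Ioi (hpos n) one_pos h
        _ ≤ _ := by have := (hpos n 1 one_pos).le; gcongr; exact le_max_right _ _
  -- At `τ = s` the `G₁` term is the cheaper one, and at `τ = t` the `G₀` term, so `K` dominates `s
  -- ‖a‖_{G₁}` and `‖a‖_{G₀}` respectively.
  have hKs : s * planeNorm r a ≤ ∑' n, φ n s := by
    refine le_trans (le_coupleG_K r fun v w hvw => ?_) (hK s hs)
    rw [← hvw]
    calc _ ≤ s * (planeNorm r v + planeNorm r w) := by gcongr; exact planeNorm_add_le Fact.out v w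
      _ ≤ _ := by rw [mul_add]; gcongr; exact h1 v
  have hKt : planeNorm 1 a ≤ ∑' n, φ n t := by
    refine le_trans (le_coupleG_K r fun v w hvw => ?_) (hK t ht)
    rw [← hvw]
    exact (planeNorm_add_le one_pos v w).trans (by gcongr; exact h2 w)
  obtain ⟨z, x, hz, hx, hzx⟩ := exists_hasSum_of_le_tsum (κ := s / t) (div_pos hs ht)
    (hsumτ s hs) (hsumτ t ht) (fun n => hpos n s hs)
    (fun n => by
      rw [div_mul_eq_mul_div, div_le_iff₀ ht, mul_comm (φ n s)]
      exact (hφ n).mul_le_mul_of_pos_Ioi (hpos n) hs hst)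
    (fun n => (hφ n).le_of_pos_Ioi (hpos n) hs hst)
    (planeNorm_nonneg 1 a)
    (by
      rw [div_mul_eq_mul_div, div_le_iff₀ ht, mul_assoc, mul_comm _ t]
      gcongr
      exact h2 a)
    (h1 a) hKs hKt
  have hy : HasSum (fun n => z n / s) (planeNorm r a) := by
    simpa [hs.ne'] using hz.div_const s
  refine ⟨fun n => x n • e + (z n / s) • e', fun n => ?_, ?_, fun n τ hτ => ?_⟩
  · rw [coupleG_sum_eq_top]; trivial
  · have hu : HasSum (fun n => x n • e + (z n / s) • e') a := by
      simpa only [hea] using (hx.smul_const e).add (hy.smul_const e')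
    have hlim := (tendsto_const_nhds (x := a)).sub hu.tendsto_sum_nat
    have hcont : Continuous (planeNorm 1) := by unfold planeNorm; fun_prop
    have hlim' := (hcont.tendsto _).comp hlim
    have h00 : planeNorm 1 (a - a) = 0 := by simp [planeNorm]
    rw [h00] at hlim'
    exact squeeze_zero (fun N => coupleG_K_nonneg r zero_le_one _)
      (fun N => coupleG_K_le_planeNorm_one r zero_le_one _) hlim'
  · obtain ⟨hz0, hzp, hxq, hxz, hzx⟩ := hzx n
    -- Coordinates along the extreme rays; if `s = t` the cone is a single ray and all the mass goes
    -- to `m₁`.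
    obtain ⟨m₀, m₁, hm₀, hm₁, hmx, hmy⟩ : ∃ m₀ m₁ : ℝ, 0 ≤ m₀ ∧ 0 ≤ m₁ ∧
        m₀ * s + m₁ * t = x n ∧ m₀ + m₁ = z n / s := by
      have hxz' : x n ≤ t * (z n / s) := by
        rw [div_mul_eq_mul_div, div_le_iff₀ ht] at hxz
        rw [mul_div_assoc', le_div_iff₀ hs]; linarith
      have hzx' : s * (z n / s) ≤ x n := by rwa [mul_div_cancel₀ _ hs.ne']
      rcases hst.eq_or_lt with rfl | hlt
      · exact ⟨0, z n / s, le_rfl, by positivity, by linarith, by ring⟩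
      · have hts : 0 < t - s := sub_pos.2 hlt
        refine ⟨(t * (z n / s) - x n) / (t - s), (x n - s * (z n / s)) / (t - s),
          div_nonneg (by linarith) hts.le, div_nonneg (by linarith) hts.le, ?_, ?_⟩
        · generalize z n / s = y
          field_simp
          ring
        · generalize z n / s = y
          field_simp
          ring
    have := coupleG_K_le_of_coneBound r he hs hst C.2 hm₀ hm₁ (hφ n) (hpos n)
      (by rw [hmy, mul_div_cancel₀ _ hs.ne']; exact hzp) (by rw [hmx]; exact hxq) hτ
    rwa [hmx, hmy] at this

theorem coupleG_gamma_lt : (coupleG r).gamma < ENNReal.ofReal √2 := by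
  have hr0 : 0 < r := Fact.out
  have hs : 0 < √r := Real.sqrt_pos.2 hr0
  have hss : √r ^ 2 = r := Real.sq_sqrt hr0.le
  have key : ∀ C : ℝ, C < 2 → (coupleG r).IsKDivisibilityBound (Real.toNNReal √C) →
      (coupleG r).gamma < ENNReal.ofReal √2 := by
    intro C hC h
    refine (iInf₂_le _ h).trans_lt ?_
    exact (ENNReal.ofReal_lt_ofReal_iff (by positivity)).2 ((Real.sqrt_lt_sqrt_iff_of_pos (by norm_num)).2 hC)
  have hzero : ∀ s t C : ℝ, 0 < s → 0 ≤ C → ConeBound r s t C 0 0 := by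
    intro s t C hs hC x y hy hx _
    have : 0 ≤ x := (by positivity : 0 ≤ s * y).trans hx
    constructor <;> simp [planeNorm] <;> positivity
  have hpos : ∀ {ρ : ℝ}, 0 < ρ → ∀ a : Fin 2 → ℝ, a ≠ 0 → 0 < planeNorm ρ a := by
    intro ρ hρ a ha
    have : Fact (0 < ρ) := ⟨hρ⟩
    rw [← norm_toFun_symm_eq_planeNorm, norm_pos_iff]
    simpa using ha
  rcases le_total 1 r with h | h
  · refine key (2 - 1 / r) (by have := one_div_pos.2 hr0; linarith) ?_
    refine coupleG_isKDivisibilityBound r (s := (√r)⁻¹) (t := 1) (by positivity)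
      (inv_le_one_of_one_le₀ (Real.one_le_sqrt.2 h)) (fun v => ?_) (fun v => ?_) (fun a => ?_)
    · rw [inv_mul_le_iff₀ hs]
      refine planeNorm_le_mul (mul_nonneg hs.le (planeNorm_nonneg _ _)) ?_
      rw [mul_pow, hss, planeNorm_sq zero_le_one]
      nlinarith [mul_le_mul_of_nonneg_right h (sq_nonneg (v 0))]
    · rw [one_mul]
      refine planeNorm_le_mul (planeNorm_nonneg _ _) ?_
      rw [planeNorm_sq hr0.le]
      nlinarith [mul_le_mul_of_nonneg_right h (sq_nonneg (v 1))]
    · rcases eq_or_ne a 0 with rfl | ha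
      · exact ⟨0, 0, by simp, hzero _ _ _ (by positivity) (NNReal.coe_nonneg _)⟩
      have h1 := hpos one_pos a ha
      have h2 := hpos hr0 a ha
      refine ⟨_, _, ?_, (coneBound_of_one_le h (a := a)).mono (by positivity) ?_⟩
      · ext i; fin_cases i <;> simp <;> field_simp
      · rw [Real.coe_toNNReal _ (Real.sqrt_nonneg _)]
        refine Real.sqrt_le_sqrt ?_
        rw [div_pow, div_pow]
        have e1 := planeNorm_sq zero_le_one a
        have e2 := planeNorm_sq hr0.le a
        have p1 : 0 < planeNorm 1 a ^ 2 := by positivity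
        have p2 : 0 < planeNorm r a ^ 2 := by positivity
        generalize planeNorm 1 a ^ 2 = X at *
        generalize planeNorm r a ^ 2 = Y at *
        -- `C² = a₀²/X + r a₁²/Y = 2 - a₁²/X - a₀²/Y`. Both `X` and `Y` are at most `r X`, so the
        -- subtracted terms add up to at least `(a₀² + a₁²)/(r X) = 1/r`.
        have hY : Y ≤ r * X := by
          rw [e1, e2]; nlinarith [mul_le_mul_of_nonneg_right h (sq_nonneg (a 0))]
        have i1 : a 0 ^ 2 / X = 1 - a 1 ^ 2 / X := by
          field_simp; linarith
        have i2 : r * (a 1 ^ 2 / Y) = 1 - a 0 ^ 2 / Y := by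
          field_simp; linarith
        have i3 : a 0 ^ 2 / (r * X) ≤ a 0 ^ 2 / Y := by gcongr
        have i4 : a 1 ^ 2 / (r * X) ≤ a 1 ^ 2 / X := by
          gcongr; nlinarith
        have i5 : 1 / r = a 0 ^ 2 / (r * X) + a 1 ^ 2 / (r * X) := by
          field_simp; linarith
        linarith
  · refine key (2 - r) (by linarith) ?_
    refine coupleG_isKDivisibilityBound r (s := 1) (t := (√r)⁻¹) one_pos
      ((one_le_inv₀ hs).2 (Real.sqrt_le_one.2 h)) (fun v => ?_) (fun v => ?_) (fun a => ?_)
    · rw [one_mul]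
      refine planeNorm_le_mul (planeNorm_nonneg _ _) ?_
      rw [planeNorm_sq zero_le_one]
      nlinarith [mul_le_mul_of_nonneg_right h (sq_nonneg (v 1))]
    · rw [← div_eq_inv_mul, le_div_iff₀ hs, mul_comm]
      refine (sq_le_sq₀ (mul_nonneg hs.le (planeNorm_nonneg _ _)) (planeNorm_nonneg _ _)).1 ?_
      rw [mul_pow, hss, planeNorm_sq zero_le_one, planeNorm_sq hr0.le]
      nlinarith [mul_le_mul_of_nonneg_right h (sq_nonneg (v 0))]
    · rcases eq_or_ne a 0 with rfl | ha
      · exact ⟨0, 0, by simp, hzero _ _ _ one_pos (NNReal.coe_nonneg _)⟩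
      have h1 := hpos one_pos a ha
      have h2 := hpos hr0 a ha
      refine ⟨_, _, ?_, (coneBound_of_le_one hr0 (a := a)).mono one_pos ?_⟩
      · ext i; fin_cases i <;> simp <;> field_simp
      · rw [Real.coe_toNNReal _ (Real.sqrt_nonneg _)]
        refine Real.sqrt_le_sqrt ?_
        rw [div_pow, div_pow]
        have e1 := planeNorm_sq zero_le_one a
        have e2 := planeNorm_sq hr0.le a
        have p1 : 0 < planeNorm 1 a ^ 2 := by positivity
        have p2 : 0 < planeNorm r a ^ 2 := by positivity
        generalize planeNorm 1 a ^ 2 = X at *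
        generalize planeNorm r a ^ 2 = Y at *
        -- `C² = a₀²/Y + a₁²/X = 2 - r a₁²/Y - a₀²/X`, and the subtracted terms add up to at least
        -- `r (a₀² + a₁²)/X = r`.
        have hY : Y ≤ X := by
          rw [e1, e2]; nlinarith [mul_le_mul_of_nonneg_right h (sq_nonneg (a 1))]
        have i1 : a 1 ^ 2 / X = 1 - a 0 ^ 2 / X := by
          field_simp; linarith
        have i2 : a 0 ^ 2 / Y = 1 - r * (a 1 ^ 2 / Y) := by
          field_simp; linarith
        have i3 : r * (a 1 ^ 2 / X) ≤ r * (a 1 ^ 2 / Y) := by gcongr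
        have i4 : r * (a 0 ^ 2 / X) ≤ 1 * (a 0 ^ 2 / X) := by gcongr
        have i5 : r = r * (a 0 ^ 2 / X) + r * (a 1 ^ 2 / X) := by
          field_simp; linarith
        linarith

end coupleG

/-! ### Integral operators on weighted `L¹` spaces. -/

section WeightedL1

variable {Ω : Type*} [MeasurableSpace Ω] {μ : Measure Ω} {w : Ω → ℝ}

theorem integrable_weighted_iff {E : Type*} [NormedAddCommGroup E] [NormedSpace ℝ E]
    (hm : Measurable w) (hp : ∀ᵐ s ∂μ, 0 < w s) {f : Ω → E} :
    Integrable f (weighted μ w) ↔ Integrable (fun s => w s • f s) μ := by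
  rw [weighted, integrable_withDensity_iff_integrable_smul' hm.ennreal_ofReal (by simp)]
  refine integrable_congr ?_
  filter_upwards [hp] with s hs
  rw [ENNReal.toReal_ofReal hs.le]

theorem integral_weighted {E : Type*} [NormedAddCommGroup E] [NormedSpace ℝ E]
    (hm : Measurable w) (hp : ∀ᵐ s ∂μ, 0 < w s) (f : Ω → E) :
    ∫ s, f s ∂(weighted μ w) = ∫ s, w s • f s ∂μ := by
  rw [weighted, integral_withDensity_eq_integral_toReal_smul hm.ennreal_ofReal (by simp)]
  refine integral_congr_ae ?_
  filter_upwards [hp] with s hs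
  rw [ENNReal.toReal_ofReal hs.le]

theorem integrable_mul_Lp_weighted (hm : Measurable w) (hp : ∀ᵐ s ∂μ, 0 < w s)
    (f : Lp ℝ 1 (weighted μ w)) : Integrable (fun s => w s * f s) μ :=
  (integrable_weighted_iff hm hp).1 (L1.integrable_coeFn f)

theorem norm_Lp_weighted (hm : Measurable w) (hp : ∀ᵐ s ∂μ, 0 < w s)
    (f : Lp ℝ 1 (weighted μ w)) : ‖f‖ = ∫ s, w s * |f s| ∂μ := by
  rw [L1.norm_eq_integral_norm, integral_weighted hm hp]
  rfl

theorem integrable_mul_Lp_weighted_of_le (hm : Measurable w) (hp : ∀ᵐ s ∂μ, 0 < w s)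
    {v : Ω → ℝ} (hv : Measurable v) {k : ℝ} (hvw : ∀ᵐ s ∂μ, |v s| ≤ k * w s)
    (f : Lp ℝ 1 (weighted μ w)) : Integrable (fun s => v s * f s) μ := by
  refine ((integrable_mul_Lp_weighted hm hp f).norm.const_mul k).mono'
    (hv.aestronglyMeasurable.mul ((Lp.aestronglyMeasurable f).mono_ac (ac_weighted hm hp))) ?_
  filter_upwards [hp, hvw] with s hs hvs
  rw [norm_mul, norm_mul, Real.norm_eq_abs, Real.norm_of_nonneg hs.le, ← mul_assoc]
  gcongr

/-- The operator `f ↦ (∫ f w₀) e + (∫ f w₁) e'` on a weighted `L¹` space. -/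
theorem exists_clm_Lp_weighted {E : Type*} [NormedAddCommGroup E] [NormedSpace ℝ E]
    [CompleteSpace E]
    (hm : Measurable w) (hp : ∀ᵐ s ∂μ, 0 < w s) {w₀ w₁ : Ω → ℝ} (hm₀ : Measurable w₀)
    (hm₁ : Measurable w₁) {k₀ k₁ C : ℝ} (h₀ : ∀ᵐ s ∂μ, |w₀ s| ≤ k₀ * w s)
    (h₁ : ∀ᵐ s ∂μ, |w₁ s| ≤ k₁ * w s) {e e' : E} (hC : 0 ≤ C)
    (hb : ∀ᵐ s ∂μ, ‖w₀ s • e + w₁ s • e'‖ ≤ C * w s) :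
    ∃ T : Lp ℝ 1 (weighted μ w) →L[ℝ] E, ‖T‖ ≤ C ∧
      ∀ f, T f = (∫ s, w₀ s * f s ∂μ) • e + (∫ s, w₁ s * f s ∂μ) • e' := by
  have hac := ac_weighted hm hp
  have i₀ := integrable_mul_Lp_weighted_of_le hm hp hm₀ h₀
  have i₁ := integrable_mul_Lp_weighted_of_le hm hp hm₁ h₁
  have hadd : ∀ (v : Ω → ℝ), (∀ f : Lp ℝ 1 (weighted μ w), Integrable (fun s => v s * f s) μ) →
      ∀ f g : Lp ℝ 1 (weighted μ w), ∫ s, v s * (f + g : Lp ℝ 1 (weighted μ w)) s ∂μ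
        = ∫ s, v s * f s ∂μ + ∫ s, v s * g s ∂μ := by
    intro v hv f g
    rw [← integral_add (hv f) (hv g)]
    refine integral_congr_ae ?_
    filter_upwards [hac.ae_le (Lp.coeFn_add f g)] with s hs
    rw [hs, Pi.add_apply, mul_add]
  have hsmul : ∀ (v : Ω → ℝ) (c : ℝ) (f : Lp ℝ 1 (weighted μ w)),
      ∫ s, v s * (c • f : Lp ℝ 1 (weighted μ w)) s ∂μ = c * ∫ s, v s * f s ∂μ := by
    intro v c f
    rw [← integral_const_mul]
    refine integral_congr_ae ?_
    filter_upwards [hac.ae_le (Lp.coeFn_smul c f)] with s hs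
    rw [hs, Pi.smul_apply, smul_eq_mul]
    ring
  let L : Lp ℝ 1 (weighted μ w) →ₗ[ℝ] E :=
    { toFun := fun f => (∫ s, w₀ s * f s ∂μ) • e + (∫ s, w₁ s * f s ∂μ) • e'
      map_add' := fun f g => by
        rw [hadd w₀ i₀, hadd w₁ i₁]; simp only [add_smul]; abel
      map_smul' := fun c f => by
        rw [hsmul, hsmul, RingHom.id_apply, smul_add, smul_smul, smul_smul] }
  have hL : ∀ f, ‖L f‖ ≤ C * ‖f‖ := by
    intro f
    have hLf : L f = (∫ s, w₀ s * f s ∂μ) • e + (∫ s, w₁ s * f s ∂μ) • e' := rfl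
    rw [hLf]
    -- The two terms merge into one vector-valued integral of `f (w₀ e + w₁ e')`, to which the
    -- pointwise bound `hb` applies.
    rw [← integral_smul_const, ← integral_smul_const,
      ← integral_add ((i₀ f).smul_const e) ((i₁ f).smul_const e'), norm_Lp_weighted hm hp,
      ← integral_const_mul]
    refine norm_integral_le_of_norm_le ?_ ?_
    · refine ((integrable_mul_Lp_weighted hm hp f).norm.const_mul C).congr ?_
      filter_upwards [hp] with s hs
      rw [norm_mul, Real.norm_of_nonneg hs.le, Real.norm_eq_abs]
    · filter_upwards [hb] with s hs
      have : (w₀ s * f s) • e + (w₁ s * f s) • e' = f s • (w₀ s • e + w₁ s • e') := by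
        rw [smul_add, smul_smul, smul_smul, mul_comm (f s), mul_comm (f s)]
      rw [this, norm_smul, Real.norm_eq_abs, mul_comm, ← mul_assoc]
      gcongr
  exact ⟨L.mkContinuous C hL, L.mkContinuous_norm_le hC hL, fun f => rfl⟩

end WeightedL1

/-! ### Operators from a weighted `L¹` couple to `G`. -/

section Operator

variable {Ω : Type*} [MeasurableSpace Ω] {μ : Measure Ω} {w₀ w₁ : Ω → ℝ}

theorem memLp_const_weighted {w : Ω → ℝ} (hm : Measurable w) (hp : ∀ᵐ s ∂μ, 0 < w s)
    (hi : Integrable w μ) : MemLp (fun _ => (1 : ℝ)) 1 (weighted μ w) := by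
  rw [memLp_one_iff_integrable, integrable_weighted_iff hm hp]
  simpa using hi

/-- An operator on `L¹` is bounded by the size of its kernel, here `w₀ e + w₁ e'`. Since `(w₀, w₁)`
lies in the cone almost everywhere, `ConeBound` is exactly the required kernel estimate. -/
theorem exists_operator_of_coneBound (r : ℝ) [Fact (0 < r)]
    (hm₀ : Measurable w₀) (hm₁ : Measurable w₁)
    (hp₀ : ∀ᵐ s ∂μ, 0 < w₀ s) (hp₁ : ∀ᵐ s ∂μ, 0 < w₁ s) (hi₀ : Integrable w₀ μ)
    {s t C : ℝ} (hs : 0 < s) (hC : 0 ≤ C) {e e' : Fin 2 → ℝ} (h : ConeBound r s t C e e')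
    (h1 : ∀ᵐ x ∂μ, s * w₁ x ≤ w₀ x) (h2 : ∀ᵐ x ∂μ, w₀ x ≤ t * w₁ x) :
    ∃ T : BanachCouple.Operator (weightedL1Couple μ w₀ w₁ hm₀ hm₁ hp₀ hp₁) (coupleG r),
      T.norm ≤ C ∧ T.Maps (AEEqFun.const Ω (1 : ℝ))
        ((∫ x, w₀ x ∂μ) • e + (∫ x, w₁ x ∂μ) • e') := by
  have a₀₀ : ∀ᵐ x ∂μ, |w₀ x| ≤ 1 * w₀ x := by
    filter_upwards [hp₀] with x hx using by rw [abs_of_pos hx, one_mul]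
  have a₁₁ : ∀ᵐ x ∂μ, |w₁ x| ≤ 1 * w₁ x := by
    filter_upwards [hp₁] with x hx using by rw [abs_of_pos hx, one_mul]
  have a₀₁ : ∀ᵐ x ∂μ, |w₀ x| ≤ t * w₁ x := by
    filter_upwards [hp₀, h2] with x hx hx2 using by rwa [abs_of_pos hx]
  have a₁₀ : ∀ᵐ x ∂μ, |w₁ x| ≤ s⁻¹ * w₀ x := by
    filter_upwards [hp₁, h1] with x hx hx1
    rw [abs_of_pos hx, le_inv_mul_iff₀ hs]
    exact hx1
  obtain ⟨T₀, hT₀, hT₀'⟩ := exists_clm_Lp_weighted (E := EuclideanSpace ℝ (Fin 2)) hm₀ hp₀ hm₀ hm₁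
    a₀₀ a₁₀ (e := WithLp.toLp 2 e) (e' := WithLp.toLp 2 e') hC (by
      filter_upwards [hp₁, h1, h2] with x hx hx1 hx2
      rw [← WithLp.toLp_smul, ← WithLp.toLp_smul, ← WithLp.toLp_add, norm_toLp_eq_planeNorm]
      exact (h _ _ hx.le hx1 hx2).1)
  obtain ⟨T₁, hT₁, hT₁'⟩ := exists_clm_Lp_weighted (E := WeightedPlane r) hm₁ hp₁ hm₀ hm₁
    a₀₁ a₁₁ (e := (WeightedPlane.toFun r).symm e) (e' := (WeightedPlane.toFun r).symm e') hC (by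
      filter_upwards [hp₁, h1, h2] with x hx hx1 hx2
      rw [← map_smul, ← map_smul, ← map_add, norm_toFun_symm_eq_planeNorm]
      exact (h _ _ hx.le hx1 hx2).2)
  refine ⟨⟨T₀, T₁, fun f g hfg => ?_⟩, max_le hT₀ hT₁, ?_⟩
  · have hfg' : (f : Ω → ℝ) =ᵐ[μ] g := AEEqFun.mk_eq_mk.1 hfg
    have hv : ∀ v : Ω → ℝ, ∫ x, v x * f x ∂μ = ∫ x, v x * g x ∂μ := fun v =>
      integral_congr_ae (by filter_upwards [hfg'] with x hx using by rw [hx])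
    rw [hT₀', hT₁', hv, hv]
    simp [coupleG]
  · have hone := memLp_const_weighted hm₀ hp₀ hi₀
    have hco : (hone.toLp _ : Ω → ℝ) =ᵐ[μ] fun _ => (1 : ℝ) :=
      (ac_weighted hm₀ hp₀).ae_le hone.coeFn_toLp
    refine ⟨hone.toLp _, 0, ?_, ?_⟩
    · rw [map_zero, add_zero]
      exact AEEqFun.mk_eq_mk.2 hco
    · have hv : ∀ v : Ω → ℝ, ∫ x, v x * (hone.toLp _ : Ω → ℝ) x ∂μ = ∫ x, v x ∂μ := fun v =>
        integral_congr_ae (by filter_upwards [hco] with x hx using by rw [hx, mul_one])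
      rw [map_zero, map_zero, add_zero, hT₀', hv, hv]
      simp [coupleG]

theorem planeNorm_le_norm_mul_integral (r : ℝ) [Fact (0 < r)]
    (hm₀ : Measurable w₀) (hm₁ : Measurable w₁)
    (hp₀ : ∀ᵐ s ∂μ, 0 < w₀ s) (hp₁ : ∀ᵐ s ∂μ, 0 < w₁ s) (hi₀ : Integrable w₀ μ)
    {a : Fin 2 → ℝ}
    (T : BanachCouple.Operator (weightedL1Couple μ w₀ w₁ hm₀ hm₁ hp₀ hp₁) (coupleG r))
    (hT : T.Maps (AEEqFun.const Ω (1 : ℝ)) a) :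
    planeNorm 1 a ≤ T.norm * ∫ x, w₀ x ∂μ := by
  obtain ⟨x, y, hxy, rfl⟩ := hT
  have h₀ := memLp_const_weighted hm₀ hp₀ hi₀
  have e₀ : (weightedL1Couple μ w₀ w₁ hm₀ hm₁ hp₀ hp₁).i₀ (h₀.toLp _) = AEEqFun.const Ω (1 : ℝ) :=
    AEEqFun.mk_eq_mk.2 ((ac_weighted hm₀ hp₀).ae_le h₀.coeFn_toLp)
  -- Since `1` lies in the first space, `1 - x = y` lies in the intersection; thus `T 1` may be
  -- computed by `T.T₀` alone.
  have hag := T.agree (h₀.toLp _ - x) y (by rw [map_sub, e₀, ← hxy]; abel)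
  rw [← hag, ← map_add, ← map_add, add_sub_cancel, ← norm_toLp_eq_planeNorm]
  have hn : ‖h₀.toLp _‖ = ∫ x, w₀ x ∂μ := by
    rw [norm_Lp_weighted hm₀ hp₀]
    refine integral_congr_ae ?_
    filter_upwards [(ac_weighted hm₀ hp₀).ae_le h₀.coeFn_toLp] with x hx
    rw [hx, abs_one, mul_one]
  rw [← hn]
  exact (T.T₀.le_opNorm _).trans (mul_le_mul_of_nonneg_right (le_max_left _ _) (norm_nonneg _))

end Operator

/-! ### The weights: ratio and total mass. -/

section Weights

variable {r : ℝ}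

theorem weight₀_eq (hr : 0 < r) (a : ℝ) {t : ℝ} (ht : 0 < t) :
    HasDerivAt (gamma₀ r a) (weight₀ r a t) t ∧ weight₀ r a t =
      ((Real.cos a) ^ 2 / (1 + t) ^ 3 + r ^ 2 * (Real.sin a) ^ 2 / (1 + t * r) ^ 3) /
      √((Real.cos a) ^ 2 / (1 + t) ^ 2 + r ^ 2 * (Real.sin a) ^ 2 / (1 + t * r) ^ 2) := by
  have hR := radicand_pos hr (pow_pos hr 2) a ht 2
  have hd := (hasDerivAt_id t).mul ((hasDerivAt_radicand hr (r ^ 2) a ht).sqrt hR.ne')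
  have he : weight₀ r a t = _ := hd.deriv
  refine ⟨hd.differentiableAt.hasDerivAt, he.trans ?_⟩
  have hs := Real.sqrt_pos.2 hR
  have hsq := Real.sq_sqrt hR.le
  simp only [id]
  generalize √((Real.cos a) ^ 2 / (1 + t) ^ 2
    + r ^ 2 * (Real.sin a) ^ 2 / (1 + t * r) ^ 2) = S at hs hsq
  have h1 : (1 + t) ≠ 0 := by positivity
  have h2 : (1 + t * r) ≠ 0 := by positivity
  have key : S ^ 2
      - t * ((Real.cos a) ^ 2 / (1 + t) ^ 3 + r ^ 2 * r * (Real.sin a) ^ 2 / (1 + t * r) ^ 3)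
      = (Real.cos a) ^ 2 / (1 + t) ^ 3 + r ^ 2 * (Real.sin a) ^ 2 / (1 + t * r) ^ 3 := by
    rw [hsq]
    field_simp
    ring
  rw [← key]
  have := hs.ne'
  field_simp
  ring

theorem weight₁_eq (hr : 0 < r) (a : ℝ) {t : ℝ} (ht : 0 < t) :
    HasDerivAt (gamma₁ r a) (-weight₁ r a t) t ∧ weight₁ r a t =
      ((Real.cos a) ^ 2 / (1 + t) ^ 3 + r ^ 2 * (Real.sin a) ^ 2 / (1 + t * r) ^ 3) /
      √((Real.cos a) ^ 2 / (1 + t) ^ 2 + r * (Real.sin a) ^ 2 / (1 + t * r) ^ 2) := by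
  have hR := radicand_pos hr hr a ht 2
  have hd := (hasDerivAt_radicand hr r a ht).sqrt hR.ne'
  have he : deriv (gamma₁ r a) t = _ := hd.deriv
  refine ⟨by rw [weight₁, neg_neg]; exact hd.differentiableAt.hasDerivAt, ?_⟩
  rw [weight₁, he, ← neg_div, sq r]
  have := (Real.sqrt_pos.2 hR).ne'
  field_simp

/-- The two weights have the same numerator, so their ratio is that of the square roots in the
denominators. The radicands differ only by a factor `r` in the second term, which confines `w₀/w₁`
to the cone. -/
theorem weight₀_le_mul_weight₁ (hr : 0 < r) (a : ℝ) {t k : ℝ} (ht : 0 < t) (hk : 0 ≤ k)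
    (h1 : 1 ≤ k ^ 2) (h2 : 1 ≤ k ^ 2 * r) : weight₀ r a t ≤ k * weight₁ r a t := by
  rw [(weight₀_eq hr a ht).2, (weight₁_eq hr a ht).2, mul_div_assoc']
  have hD := Real.sqrt_pos.2 (radicand_pos hr (pow_pos hr 2) a ht 2)
  have hE := Real.sqrt_pos.2 (radicand_pos hr hr a ht 2)
  rw [div_le_div_iff₀ hD hE, mul_comm k, mul_assoc]
  refine mul_le_mul_of_nonneg_left ?_ (radicand_pos hr (pow_pos hr 2) a ht 3).le
  rw [← Real.sqrt_sq hk, ← Real.sqrt_mul (sq_nonneg k)]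
  refine Real.sqrt_le_sqrt ?_
  have hx : 0 ≤ Real.cos a ^ 2 / (1 + t) ^ 2 := by positivity
  have hy : 0 ≤ r * Real.sin a ^ 2 / (1 + t * r) ^ 2 := by positivity
  have he : r ^ 2 * Real.sin a ^ 2 / (1 + t * r) ^ 2
    = r * (r * Real.sin a ^ 2 / (1 + t * r) ^ 2) := by ring
  rw [he]
  nlinarith [mul_le_mul_of_nonneg_right h1 hx, mul_le_mul_of_nonneg_right h2 hy]

theorem weight₁_le_mul_weight₀ (hr : 0 < r) (a : ℝ) {t k : ℝ} (ht : 0 < t) (hk : 0 ≤ k)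
    (h1 : 1 ≤ k ^ 2) (h2 : r ≤ k ^ 2) : weight₁ r a t ≤ k * weight₀ r a t := by
  rw [(weight₀_eq hr a ht).2, (weight₁_eq hr a ht).2, mul_div_assoc']
  have hD := Real.sqrt_pos.2 (radicand_pos hr (pow_pos hr 2) a ht 2)
  have hE := Real.sqrt_pos.2 (radicand_pos hr hr a ht 2)
  rw [div_le_div_iff₀ hE hD, mul_comm k, mul_assoc]
  refine mul_le_mul_of_nonneg_left ?_ (radicand_pos hr (pow_pos hr 2) a ht 3).le
  rw [← Real.sqrt_sq hk, ← Real.sqrt_mul (sq_nonneg k)]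
  refine Real.sqrt_le_sqrt ?_
  have hx : 0 ≤ Real.cos a ^ 2 / (1 + t) ^ 2 := by positivity
  have hy : 0 ≤ r * Real.sin a ^ 2 / (1 + t * r) ^ 2 := by positivity
  have he : r ^ 2 * Real.sin a ^ 2 / (1 + t * r) ^ 2
    = r * (r * Real.sin a ^ 2 / (1 + t * r) ^ 2) := by ring
  rw [he]
  nlinarith [mul_le_mul_of_nonneg_right h1 hx, mul_le_mul_of_nonneg_right h2 hy]

theorem tendsto_one_add_mul_inv_atTop {k : ℝ} (hk : 0 < k) :
    Tendsto (fun t : ℝ => (1 + t * k)⁻¹) atTop (𝓝 0) :=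
  tendsto_inv_atTop_zero.comp
    (tendsto_atTop_add_const_left _ _ (tendsto_id.atTop_mul_const hk))

theorem tendsto_gamma₀_atTop (hr : 0 < r) (a : ℝ) : Tendsto (gamma₀ r a) atTop (𝓝 1) := by
  have h1 := tendsto_one_add_mul_inv_atTop one_pos
  have h2 := tendsto_one_add_mul_inv_atTop hr
  -- With `t` moved under the root, the fractions become `t/(1+t) = 1 - (1+t)⁻¹` and `tr/(1+tr) = 1
  -- - (1+tr)⁻¹`.
  have h := ((((h1.const_sub 1).pow 2).const_mul (Real.cos a ^ 2)).add
    (((h2.const_sub 1).pow 2).const_mul (Real.sin a ^ 2))).sqrt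
  simp only [sub_zero, one_pow, mul_one, Real.cos_sq_add_sin_sq, Real.sqrt_one] at h
  refine h.congr' ?_
  filter_upwards [eventually_gt_atTop 0] with t ht
  have e1 : (1 + t) ≠ 0 := by positivity
  have e2 : (1 + t * r) ≠ 0 := by positivity
  have hsq : ∀ D, t * √D = √(t ^ 2 * D) := fun D => by
    rw [Real.sqrt_mul (sq_nonneg t), Real.sqrt_sq ht.le]
  rw [gamma₀, hsq]
  congr 1
  field_simp
  ring

theorem tendsto_gamma₁_atTop (hr : 0 < r) (a : ℝ) : Tendsto (gamma₁ r a) atTop (𝓝 0) := by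
  have h1 := tendsto_one_add_mul_inv_atTop one_pos
  have h2 := tendsto_one_add_mul_inv_atTop hr
  have h := (((h1.pow 2).const_mul (Real.cos a ^ 2)).add
    ((h2.pow 2).const_mul (r * Real.sin a ^ 2))).sqrt
  simp only [ne_eq, OfNat.ofNat_ne_zero, not_false_eq_true, zero_pow, mul_zero, add_zero,
    Real.sqrt_zero, mul_one] at h
  refine h.congr fun t => ?_
  simp only [gamma₁, div_eq_mul_inv, inv_pow]

theorem continuousAt_radicand_zero (q a : ℝ) : ContinuousAt (fun t : ℝ =>
    (Real.cos a) ^ 2 / (1 + t) ^ 2 + q * (Real.sin a) ^ 2 / (1 + t * r) ^ 2) 0 := by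
  refine (ContinuousAt.div (by fun_prop) (by fun_prop) (by norm_num)).add
    (ContinuousAt.div (by fun_prop) (by fun_prop) (by norm_num))

/-- `γ₀` climbs from `0` to `1 = ‖α‖_{G₀}`. Together with the fall of `γ₁` from `‖α‖_{G₁}` to `0`,
this makes the masses of the weights the norm pair of `α`. -/
theorem integral_weight₀ (hr : 0 < r) (a : ℝ) :
    IntegrableOn (weight₀ r a) (Ioi 0) ∧ ∫ t in Ioi 0, weight₀ r a t = 1 := by
  have hc : ContinuousWithinAt (gamma₀ r a) (Ici 0) 0 :=
    (continuousAt_id.mul (continuousAt_radicand_zero (r ^ 2) a).sqrt).continuousWithinAt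
  have hd : ∀ t ∈ Ioi (0 : ℝ), HasDerivAt (gamma₀ r a) (weight₀ r a t) t :=
    fun t ht => (weight₀_eq hr a ht).1
  have hp : ∀ t ∈ Ioi (0 : ℝ), 0 ≤ weight₀ r a t := fun t ht => (weight₀_pos hr a ht).le
  refine ⟨integrableOn_Ioi_deriv_of_nonneg hc hd hp (tendsto_gamma₀_atTop hr a), ?_⟩
  rw [integral_Ioi_of_hasDerivAt_of_nonneg hc hd hp (tendsto_gamma₀_atTop hr a)]
  simp [gamma₀]

theorem integral_weight₁ (hr : 0 < r) (a : ℝ) :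
    ∫ t in Ioi 0, weight₁ r a t = planeNorm r ![Real.cos a, Real.sin a] := by
  have hc : ContinuousWithinAt (gamma₁ r a) (Ici 0) 0 :=
    (continuousAt_radicand_zero r a).sqrt.continuousWithinAt
  have hd : ∀ t ∈ Ioi (0 : ℝ), HasDerivAt (gamma₁ r a) (-weight₁ r a t) t :=
    fun t ht => (weight₁_eq hr a ht).1
  have hp : ∀ t ∈ Ioi (0 : ℝ), -weight₁ r a t ≤ 0 :=
    fun t ht => neg_nonpos.2 (weight₁_pos hr a ht).le
  rw [← neg_inj, ← integral_neg,
    integral_Ioi_of_hasDerivAt_of_nonpos hc hd hp (tendsto_gamma₁_atTop hr a)]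
  simp [gamma₁, planeNorm]

theorem planeNorm_one_cos_sin (a : ℝ) : planeNorm 1 ![Real.cos a, Real.sin a] = 1 := by
  simp [planeNorm]

end Weights

/-! ### Bounds for `c_a`. -/

section cConst

variable (r : ℝ) [hr : Fact (0 < r)]

theorem one_le_cConst (a : ℝ) : 1 ≤ cConst r a := by
  refine le_iInf₂ fun T hT => ?_
  have h := planeNorm_le_norm_mul_integral r _ _ _ _ (integral_weight₀ hr.out a).1
    T hT
  rw [planeNorm_one_cos_sin, (integral_weight₀ hr.out a).2, mul_one] at h
  exact ENNReal.one_le_ofReal.2 h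

theorem cConst_le_of_coneBound {a s t C : ℝ} {e e' : Fin 2 → ℝ} (hs : 0 < s) (hC : 0 ≤ C)
    (h : ConeBound r s t C e e') (h1 : ∀ x, 0 < x → s * weight₁ r a x ≤ weight₀ r a x)
    (h2 : ∀ x, 0 < x → weight₀ r a x ≤ t * weight₁ r a x)
    (he : e + planeNorm r ![Real.cos a, Real.sin a] • e' = ![Real.cos a, Real.sin a]) :
    cConst r a ≤ ENNReal.ofReal C := by
  obtain ⟨T, hT, hT'⟩ := exists_operator_of_coneBound (μ := volume.restrict (Ioi (0 : ℝ)))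
    (w₀ := weight₀ r a) (w₁ := weight₁ r a) r (measurable_deriv _) (measurable_deriv _).neg
    ((ae_restrict_mem measurableSet_Ioi).mono fun _ ht => weight₀_pos hr.out a ht)
    ((ae_restrict_mem measurableSet_Ioi).mono fun _ ht => weight₁_pos hr.out a ht)
    (integral_weight₀ hr.out a).1 hs hC h
    ((ae_restrict_mem measurableSet_Ioi).mono fun _ ht => h1 _ ht)
    ((ae_restrict_mem measurableSet_Ioi).mono fun _ ht => h2 _ ht)
  rw [(integral_weight₀ hr.out a).2, integral_weight₁ hr.out a, one_smul, he] at hT'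
  exact (iInf₂_le T hT').trans (ENNReal.ofReal_le_ofReal hT)

theorem planeNorm_cos_sin_pos (a : ℝ) : 0 < planeNorm r ![Real.cos a, Real.sin a] := by
  rw [planeNorm, Real.sqrt_pos]
  -- The exponent `0` turns the denominators into `1`.
  simpa using radicand_pos hr.out hr.out a one_pos 0

theorem cConst_le_of_one_le (h : 1 ≤ r) (a : ℝ) : cConst r a ≤ ENNReal.ofReal
    √(Real.cos a ^ 2 + r * (Real.sin a / planeNorm r ![Real.cos a, Real.sin a]) ^ 2) := by
  have hr0 := hr.out
  have hs : 0 < √r := Real.sqrt_pos.2 hr0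
  have hn := planeNorm_cos_sin_pos r a
  have hb := coneBound_of_one_le h (a := ![Real.cos a, Real.sin a])
  simp only [planeNorm_one_cos_sin, Matrix.cons_val_zero, Matrix.cons_val_one, div_one] at hb
  refine cConst_le_of_coneBound r (by positivity) (Real.sqrt_nonneg _) hb
    (fun x hx => ?_) (fun x hx => ?_) ?_
  · rw [inv_mul_le_iff₀ hs]
    refine weight₁_le_mul_weight₀ hr0 a hx hs.le ?_ ?_ <;> rw [Real.sq_sqrt hr0.le]
    exact h
  · exact weight₀_le_mul_weight₁ hr0 a hx zero_le_one (by norm_num) (by linarith)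
  · ext i; fin_cases i <;> simp <;> field_simp

theorem cConst_le_of_le_one (h : r ≤ 1) (a : ℝ) : cConst r a ≤ ENNReal.ofReal
    √((Real.cos a / planeNorm r ![Real.cos a, Real.sin a]) ^ 2 + Real.sin a ^ 2) := by
  have hr0 := hr.out
  have hs : 0 < √r := Real.sqrt_pos.2 hr0
  have hn := planeNorm_cos_sin_pos r a
  have hb := coneBound_of_le_one hr0 (a := ![Real.cos a, Real.sin a])
  simp only [planeNorm_one_cos_sin, Matrix.cons_val_zero, Matrix.cons_val_one, div_one] at hb
  refine cConst_le_of_coneBound r one_pos (Real.sqrt_nonneg _) hb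
    (fun x hx => ?_) (fun x hx => ?_) ?_
  · rw [one_mul, ← one_mul (weight₀ r a x)]
    exact weight₁_le_mul_weight₀ hr0 a hx zero_le_one (by norm_num) (by linarith)
  · refine weight₀_le_mul_weight₁ hr0 a hx (by positivity) ?_ ?_ <;>
      rw [inv_pow, Real.sq_sqrt hr0.le]
    · exact (one_le_inv₀ hr0).2 h
    · rw [inv_mul_cancel₀ hr0.ne']
  · ext i; fin_cases i <;> simp <;> field_simp

theorem cConst_zero : cConst r 0 = 1 := by
  refine le_antisymm ?_ (one_le_cConst r 0)
  rcases le_total 1 r with h | h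
  · simpa using cConst_le_of_one_le r h 0
  · simpa [planeNorm] using cConst_le_of_le_one r h 0

theorem cConst_pi_div_two : cConst r (Real.pi / 2) = 1 := by
  have hr0 := hr.out
  refine le_antisymm ?_ (one_le_cConst r _)
  rcases le_total 1 r with h | h
  · simpa [planeNorm, hr0.le, hr0.ne'] using cConst_le_of_one_le r h (Real.pi / 2)
  · simpa using cConst_le_of_le_one r h (Real.pi / 2)

theorem cConst_lt_of_one_le (h : 1 ≤ r) {a : ℝ} (ha : a ∈ Ioo 0 (Real.pi / 2)) :
    cConst r a < ENNReal.ofReal √(1 + (Real.cos a) ^ 2) := by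
  have hc : 0 < Real.cos a := Real.cos_pos_of_mem_Ioo ⟨by linarith [ha.1, Real.pi_pos], ha.2⟩
  refine (cConst_le_of_one_le r h a).trans_lt
    ((ENNReal.ofReal_lt_ofReal_iff (by positivity)).2 (Real.sqrt_lt_sqrt (by positivity) ?_))
  have hn := planeNorm_cos_sin_pos r a
  have hsq := planeNorm_sq hr.out.le ![Real.cos a, Real.sin a]
  simp only [Matrix.cons_val_zero, Matrix.cons_val_one] at hsq
  -- This is `rc²/(b² + rc²)`, less than `1` because `b > 0`.
  have : r * (Real.sin a / planeNorm r ![Real.cos a, Real.sin a]) ^ 2 < 1 := by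
    rw [div_pow, mul_div_assoc', div_lt_one (by positivity), hsq]
    have := pow_pos hc 2
    linarith
  linarith

theorem cConst_lt_of_le_one (h : r ≤ 1) {a : ℝ} (ha : a ∈ Ioo 0 (Real.pi / 2)) :
    cConst r a < ENNReal.ofReal √(1 + (Real.sin a) ^ 2) := by
  have hr0 := hr.out
  have hs : 0 < Real.sin a := Real.sin_pos_of_pos_of_lt_pi ha.1 (by linarith [ha.2, Real.pi_pos])
  refine (cConst_le_of_le_one r h a).trans_lt
    ((ENNReal.ofReal_lt_ofReal_iff (by positivity)).2 (Real.sqrt_lt_sqrt (by positivity) ?_))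
  have hn := planeNorm_cos_sin_pos r a
  have hsq := planeNorm_sq hr.out.le ![Real.cos a, Real.sin a]
  simp only [Matrix.cons_val_zero, Matrix.cons_val_one] at hsq
  have : (Real.cos a / planeNorm r ![Real.cos a, Real.sin a]) ^ 2 < 1 := by
    rw [div_pow, div_lt_one (by positivity), hsq]
    have : 0 < r * Real.sin a ^ 2 := by positivity
    linarith
  linarith

end cConst

theorem proposition3p11 (r : ℝ) [Fact (0 < r)] :
    cConst r 0 = 1 ∧ cConst r (Real.pi / 2) = 1 ∧
    (1 ≤ r → ∀ a ∈ Ioo 0 (Real.pi / 2),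
      cConst r a < ENNReal.ofReal √(1 + (Real.cos a) ^ 2)) ∧
    (r ≤ 1 → ∀ a ∈ Ioo 0 (Real.pi / 2),
      cConst r a < ENNReal.ofReal √(1 + (Real.sin a) ^ 2)) ∧
    (coupleG r).gamma < ENNReal.ofReal √2 := by
  exact ⟨cConst_zero r, cConst_pi_div_two r, fun h _ ha => cConst_lt_of_one_le r h ha,
    fun h _ ha => cConst_lt_of_le_one r h ha, coupleG_gamma_lt r⟩
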